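/- **Setting.** All manifolds, maps, bundles and fields are smooth, and $\Gamma(W)$ denotes the smooth sections of a bundle $W$. Let $(\bar M,\bar g,\bar J)$ be an indefinite Kähler manifold: $\bar g$ is a semi-Riemannian metric of constant index $q$, $0<q<\dim\bar M$, with Levi-Civita connection $\bar\nabla$, and $\bar J$ is a $(1,1)$-tensor field with $\bar J^2=-I$, $\bar g(\bar JX,\bar JY)=\bar g(X,Y)$ and $\bar\nabla\bar J=0$. Let $M$ be an (immersed) $r$-lightlike submanifold of $\bar M$: $\mathrm{Rad}(TM)=TM\cap TM^{\perp}$ has constant rank $r\ge 1$. Let $S(TM)$ and $S(TM^\perp)$ be non-degenerate subbundles with $TM=S(TM)\perp \mathrm{Rad}(TM)$ and $TM^\perp=S(TM^\perp)\perp \mathrm{Rad}(TM)$, and let $ltr(TM)$ be a lightlike transversal bundle, i.e. an isotropic complement of $\mathrm{Rad}(TM)$ in the orthogonal complement of $S(TM)\perp S(TM^\perp)$ in $T\bar M|_M$. Put $tr(TM)=ltr(TM)\perp S(TM^\perp)$, so that $T\bar M|_M=TM\oplus tr(TM)$. For $X,Y\in\Gamma(TM)$ write $$\bar\nabla_XY=\nabla_XY+h(X,Y),\qquad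 \nabla_XY\in\Gamma(TM),\quad h(X,Y)\in\Gamma(tr(TM)),$$ and for $V\in tr(TM)$ let $BV$ be the component of $\bar JV$ in $TM$ with respect to $T\bar M|_M=TM\oplus tr(TM)$. Suppose that $M$ is a screen transversal Cauchy–Riemann (STCR) lightlike submanifold, i.e. there are vector subbundles $D_1,D_2$ of $\mathrm{Rad}(TM)$, $D_0,D'$ of $S(TM)$, $L_1$ of $ltr(TM)$ and $S$ of $S(TM^\perp)$ (zero bundles allowed) with $D_0$ non-degenerate and $$\mathrm{Rad}(TM)=D_1\oplus D_2,\quad \bar J(D_1)\subset S(TM),\quad \bar J(D_2)\subset S(TM^\perp),$$ $$S(TM)=\{\bar JD_1\oplus D'\}\perp D_0,\quad \bar J(D_0)=D_0,\quad \bar J(D')=L_1\perp S .$$ Let $D=D_0\oplus D_1\oplus\bar JD_1\subset TM$. **Theorem 3.6.** The distribution $D$ defines a totally geodesic foliation on $M$ (that is, $D$ is involutive and $\nabla_XY\in\Gamma(D)$ for all $X,Y\in\Gamma(D)$) if and only if $$Bh(X,\bar JY)=0\qquad\text{for all }X,Y\in\Gamma(D).$$ -/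

import Mathlib

open Set Bundle
open scoped Manifold ContDiff Topology

set_option linter.unusedSectionVars false

noncomputable section

namespace LightlikeGeometry

section Ambient

variable {E : Type*} [NormedAddCommGroup E] [NormedSpace ℝ E]
  {N : Type*} [TopologicalSpace N] [ChartedSpace E N]

lemma mvfderiv_congr {F : Type*} [NormedAddCommGroup F] [NormedSpace ℝ F] {u v : N → F} {p : N}
    (h : u =ᶠ[𝓝 p] v) : mvfderiv 𝓘(ℝ, E) u p = mvfderiv 𝓘(ℝ, E) v p := by
  have h0 : u p = v p := h.self_of_nhds
  ext w
  simp only [mvfderiv, h.mfderiv_eq]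
  rfl

lemma mvfderiv_clm_apply {F G : Type*} [NormedAddCommGroup F] [NormedSpace ℝ F]
    [NormedAddCommGroup G] [NormedSpace ℝ G] {L : N → F →L[ℝ] G} {a : N → F} {p : N}
    (hL : MDiffAt L p) (ha : MDiffAt a p) (v : TangentSpace 𝓘(ℝ, E) p) :
    mvfderiv 𝓘(ℝ, E) (fun y ↦ L y (a y)) p v =
      mvfderiv 𝓘(ℝ, E) L p v (a p) + L p (mvfderiv 𝓘(ℝ, E) a p v) := by
  have h1 := hL.hasMFDerivAt
  have h2 := ha.hasMFDerivAt
  have h3 := h1.2.clm_apply h2.2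
  have h4 : HasMFDerivAt 𝓘(ℝ, E) 𝓘(ℝ, G) (fun y ↦ L y (a y)) p _ := ⟨h1.1.clm_apply h2.1, h3⟩
  have h5 : (extChartAt 𝓘(ℝ, E) p).symm (extChartAt 𝓘(ℝ, E) p p) = p := extChartAt_to_inv p
  change mfderiv 𝓘(ℝ, E) 𝓘(ℝ, G) (fun y ↦ L y (a y)) p v = _
  rw [h4.mfderiv]
  change L ((extChartAt 𝓘(ℝ, E) p).symm (extChartAt 𝓘(ℝ, E) p p)) _ +
    mvfderiv 𝓘(ℝ, E) L p v (a ((extChartAt 𝓘(ℝ, E) p).symm (extChartAt 𝓘(ℝ, E) p p))) = _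
  rw [h5, add_comm]
  rfl

variable [IsManifold 𝓘(ℝ, E) ∞ N]

/-- The components at `y` of a tangent vector, in the coordinate frame of the preferred chart
at `p`. -/
def comp (p : N) (w : TangentBundle 𝓘(ℝ, E) N) : E :=
  (trivializationAt E (TangentSpace 𝓘(ℝ, E)) p w).2

lemma comp_self (p : N) (v : TangentSpace 𝓘(ℝ, E) p) : comp p ⟨p, v⟩ = v := by
  have h := TangentBundle.continuousLinearMapAt_trivializationAt (I := 𝓘(ℝ, E)) (M := N)
    (x₀ := p) (x := p) (by simp)
  rw [mfderiv_extChartAt_self] at h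
  have h2 : (trivializationAt E (TangentSpace 𝓘(ℝ, E)) p).continuousLinearMapAt ℝ p v = v := by
    rw [h]; rfl
  rw [Trivialization.continuousLinearMapAt_apply, Trivialization.linearMapAt_apply,
    if_pos (by simp)] at h2
  exact h2

lemma comp_add {p y : N} (hy : y ∈ (chartAt E p).source) (v w : TangentSpace 𝓘(ℝ, E) y) :
    comp p ⟨y, v + w⟩ = comp p ⟨y, v⟩ + comp p ⟨y, w⟩ :=
  ((trivializationAt E (TangentSpace 𝓘(ℝ, E)) p).linear ℝ (b := y) (by simpa using hy)).map_add v w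

lemma comp_smul {p y : N} (hy : y ∈ (chartAt E p).source) (c : ℝ) (v : TangentSpace 𝓘(ℝ, E) y) :
    comp p ⟨y, c • v⟩ = c • comp p ⟨y, v⟩ :=
  ((trivializationAt E (TangentSpace 𝓘(ℝ, E)) p).linear ℝ (b := y) (by simpa using hy)).map_smul c v

lemma mdifferentiableAt_comp {Y : ∀ x : N, TangentSpace 𝓘(ℝ, E) x} {p : N}
    (hY : MDiffAt (T% Y) p) : MDiffAt (fun y ↦ comp p ⟨y, Y y⟩) p :=
  ((trivializationAt E (TangentSpace 𝓘(ℝ, E)) p).mdifferentiableAt_section_iff 𝓘(ℝ, E) Y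
    (by simp)).1 hY

/-- `koszul A y u z = (A u y z + A y u z - A z y u) / 2`. -/
def koszul (A : E →L[ℝ] E →L[ℝ] E →L[ℝ] ℝ) (y : E) : E →L[ℝ] E →L[ℝ] ℝ :=
  (1 / 2 : ℝ) • (A.flip y + A y - (A.flip y).flip)

lemma koszul_apply (A : E →L[ℝ] E →L[ℝ] E →L[ℝ] ℝ) (y u z : E) :
    koszul A y u z = (A u y z + A y u z - A z y u) / 2 := by
  have : koszul A y u z = (1 / 2 : ℝ) * (A u y z + A y u z - A z y u) := rfl
  rw [this]; ring

lemma koszul_add (A : E →L[ℝ] E →L[ℝ] E →L[ℝ] ℝ) (y z : E) :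
    koszul A (y + z) = koszul A y + koszul A z := by
  refine ContinuousLinearMap.ext fun u ↦ ContinuousLinearMap.ext fun w ↦ ?_
  change _ = koszul A y u w + koszul A z u w
  have h1 : A (y + z) = A y + A z := A.map_add y z
  have h2 : A w (y + z) = A w y + A w z := (A w).map_add y z
  have h3 : A u (y + z) = A u y + A u z := (A u).map_add y z
  rw [koszul_apply, koszul_apply, koszul_apply, h1, h2, h3]
  change (A u y w + A u z w + (A y u w + A z u w) - (A w y u + A w z u)) / 2 = _
  ring

lemma koszul_smul (A : E →L[ℝ] E →L[ℝ] E →L[ℝ] ℝ) (c : ℝ) (y : E) :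
    koszul A (c • y) = c • koszul A y := by
  refine ContinuousLinearMap.ext fun u ↦ ContinuousLinearMap.ext fun w ↦ ?_
  change _ = c * koszul A y u w
  have h1 : A (c • y) = c • A y := A.map_smul c y
  have h2 : A w (c • y) = c • A w y := (A w).map_smul c y
  have h3 : A u (c • y) = c • A u y := (A u).map_smul c y
  rw [koszul_apply, koszul_apply, h1, h2, h3]
  change (c * A u y w + c * A y u w - c * A w y u) / 2 = _
  ring

variable (E N) in
/-- A semi-Riemannian metric: a smooth, symmetric, nondegenerate `(0,2)`-tensor field of constant
index (the maximal dimension of a negative definite subspace). -/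
structure SemiRiemannianMetric where
  val : ∀ x : N, TangentSpace 𝓘(ℝ, E) x →L[ℝ] TangentSpace 𝓘(ℝ, E) x →L[ℝ] ℝ
  symm : ∀ x u v, val x u v = val x v u
  nondegenerate : ∀ x u, (∀ v, val x u v = 0) → u = 0
  contMDiff : ContMDiff 𝓘(ℝ, E) (𝓘(ℝ, E).prod 𝓘(ℝ, E →L[ℝ] E →L[ℝ] ℝ)) ∞
    (fun x ↦ TotalSpace.mk' (E →L[ℝ] E →L[ℝ] ℝ) x (val x))
  index : ℕ
  isGreatest_index : ∀ x : N, IsGreatest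
    {q : ℕ | ∃ W : Submodule ℝ (TangentSpace 𝓘(ℝ, E) x),
      Module.finrank ℝ W = q ∧ ∀ v ∈ W, v ≠ 0 → val x v v < 0} index

namespace SemiRiemannianMetric

variable (g : SemiRiemannianMetric E N)

/-- The components of `g` at `y`, in the coordinate frame of the preferred chart at `p`. -/
def coord (p y : N) : E →L[ℝ] E →L[ℝ] ℝ :=
  (trivializationAt (E →L[ℝ] E →L[ℝ] ℝ)
    (fun z : N ↦ TangentSpace 𝓘(ℝ, E) z →L[ℝ] TangentSpace 𝓘(ℝ, E) z →L[ℝ] ℝ) p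
    ⟨y, g.val y⟩).2

/-- The first derivatives at `p` of the components of `g` in the preferred chart at `p`:
`g.dcoord p u v w` is the derivative of `g(v, w)` in the direction `u`. -/
def dcoord (p : N) : E →L[ℝ] E →L[ℝ] E →L[ℝ] ℝ :=
  mvfderiv 𝓘(ℝ, E) (g.coord p) p

/-- The metric at `p`, on the model space `E = T_p N`. -/
def form (p : N) : E →L[ℝ] E →L[ℝ] ℝ := g.val p

/-- `g.sharp p φ` is the vector `w` at `p` with `g(w, ·) = φ`. -/
def sharp (p : N) : (E →L[ℝ] ℝ) →L[ℝ] E :=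
  ContinuousLinearMap.inverse (g.form p)

/-- The Christoffel symbols at `p` in the preferred chart at `p`: `Γ = g.christoffel p y` satisfies
`2 g(Γ u, z) = u(g(y, z)) + y(g(u, z)) - z(g(y, u))`, where `u, y, z` stand for the coordinate
vector fields that they define. -/
def christoffel (p : N) (y : E) : E →L[ℝ] E :=
  g.sharp p ∘L koszul (g.dcoord p) y

variable [FiniteDimensional ℝ E]

lemma val_sharp (p : N) (φ : E →L[ℝ] ℝ) (z : E) :
    g.form p (g.sharp p φ) z = φ z := by
  set G : E →L[ℝ] E →L[ℝ] ℝ := g.val p with hG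
  have hinj : Function.Injective G := by
    rw [injective_iff_map_eq_zero]
    intro u hu
    exact g.nondegenerate p u (fun v ↦ by
      change G u v = 0
      rw [hu]; rfl)
  have hfr : Module.finrank ℝ E = Module.finrank ℝ (E →L[ℝ] ℝ) := by
    rw [← LinearEquiv.finrank_eq (LinearMap.toContinuousLinearMap (𝕜 := ℝ) (E := E) (F' := ℝ))]
    exact (Subspace.dual_finrank_eq (K := ℝ) (V := E)).symm
  let e : E ≃L[ℝ] (E →L[ℝ] ℝ) :=
    (LinearEquiv.ofInjectiveOfFinrankEq (G : E →ₗ[ℝ] E →L[ℝ] ℝ) hinj hfr).toContinuousLinearEquiv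
  have he : (e : E →L[ℝ] E →L[ℝ] ℝ) = G := by
    ext u v; rfl
  have : g.sharp p = (e.symm : (E →L[ℝ] ℝ) →L[ℝ] E) := by
    change ContinuousLinearMap.inverse G = _
    rw [← he, ContinuousLinearMap.inverse_equiv]
  rw [this]
  have h2 : G (e.symm φ) = φ := by
    rw [← he]; exact e.apply_symm_apply φ
  exact congrArg (fun ψ : E →L[ℝ] ℝ ↦ ψ z) h2

lemma christoffel_add (p : N) (y z : E) :
    g.christoffel p (y + z) = g.christoffel p y + g.christoffel p z := by
  rw [christoffel, koszul_add, ContinuousLinearMap.comp_add]; rfl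

lemma christoffel_smul (p : N) (c : ℝ) (y : E) :
    g.christoffel p (c • y) = c • g.christoffel p y := by
  rw [christoffel, koszul_smul, ContinuousLinearMap.comp_smul]; rfl

/-- The Levi-Civita connection of `g`. At `p`, in the preferred chart at `p`,
`∇_v Y = dY(v) + Γ(v, Y)`. -/
def leviCivita : CovariantDerivative 𝓘(ℝ, E) E (TangentSpace 𝓘(ℝ, E) : N → Type _) where
  toFun Y p :=
    (show E →L[ℝ] E from mvfderiv 𝓘(ℝ, E) (fun y ↦ comp p ⟨y, Y y⟩) p) + g.christoffel p (Y p)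
  isCovariantDerivativeOnUniv := by
    refine ⟨fun {Y Z p} hY hZ _ ↦ ?_, fun {Y f p} hY hf _ ↦ ?_⟩
    · have h1 : (fun y ↦ comp p ⟨y, (Y + Z) y⟩) =ᶠ[𝓝 p]
          (fun y ↦ comp p ⟨y, Y y⟩) + (fun y ↦ comp p ⟨y, Z y⟩) := by
        filter_upwards [chart_source_mem_nhds E p] with y hy using comp_add hy _ _
      have h2 := mvfderiv_add (mdifferentiableAt_comp hY) (mdifferentiableAt_comp hZ)
      rw [mvfderiv_congr h1, h2]
      have h3 : g.christoffel p ((Y + Z) p)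
          = g.christoffel p (Y p) + g.christoffel p (Z p) :=
        g.christoffel_add p (Y p) (Z p)
      rw [h3]
      exact add_add_add_comm (G := E →L[ℝ] E) _ _ _ _
    · have h1 : (fun y ↦ comp p ⟨y, (f • Y) y⟩) =ᶠ[𝓝 p] f • (fun y ↦ comp p ⟨y, Y y⟩) := by
        filter_upwards [chart_source_mem_nhds E p] with y hy using comp_smul hy _ _
      have h2 := mvfderiv_smul hf (mdifferentiableAt_comp hY)
      rw [mvfderiv_congr h1, h2, comp_self]
      have h3 : g.christoffel p ((f • Y) p) = f p • g.christoffel p (Y p) :=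
        g.christoffel_smul p (f p) (Y p)
      rw [h3]
      ext v
      have h4 : ∀ (c : ℝ) (a b d : E), c • a + b + c • d = c • (a + d) + b := fun c a b d ↦ by
        module
      exact h4 _ _ _ _

lemma coord_apply {p y : N} (hy : y ∈ (chartAt E p).source) (v w : TangentSpace 𝓘(ℝ, E) y) :
    g.coord p y (comp p ⟨y, v⟩) (comp p ⟨y, w⟩) = g.val y v w := by
  have hb : y ∈ (trivializationAt E (TangentSpace 𝓘(ℝ, E)) p).baseSet := by simpa using hy
  rw [coord, hom_trivializationAt_apply]
  rw [inCoordinates_apply_eq₂ (F₃ := ℝ) (E₃ := fun _ : N ↦ ℝ) hb hb (by simp)]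
  simp [comp, Trivialization.symm_apply_apply_mk _ hb]

lemma mdifferentiableAt_coord (p : N) : MDiffAt (g.coord p) p := by
  have h := (contMDiffAt_totalSpace.1 (g.contMDiff p)).2
  exact h.mdifferentiableAt (by simp)

lemma coord_symm {p y : N} (hy : y ∈ (chartAt E p).source) (a b : E) :
    g.coord p y a b = g.coord p y b a := by
  have hb : y ∈ (trivializationAt E (TangentSpace 𝓘(ℝ, E)) p).baseSet := by simpa using hy
  rw [coord, hom_trivializationAt_apply]
  rw [inCoordinates_apply_eq₂ (F₃ := ℝ) (E₃ := fun _ : N ↦ ℝ) hb hb (by simp),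
    inCoordinates_apply_eq₂ (F₃ := ℝ) (E₃ := fun _ : N ↦ ℝ) hb hb (by simp), g.symm]

lemma mvfderiv_coord_apply (p : N) (u a b : E) :
    mvfderiv 𝓘(ℝ, E) (fun y ↦ g.coord p y a b) p u = g.dcoord p u a b := by
  have h1 := mvfderiv_clm_apply (g.mdifferentiableAt_coord p)
    (mdifferentiableAt_const (c := a)) (p := p)
  have h0 : MDiffAt (fun y ↦ g.coord p y a) p :=
    (g.mdifferentiableAt_coord p).clm_apply mdifferentiableAt_const
  have h2 := mvfderiv_clm_apply h0 (mdifferentiableAt_const (c := b)) (p := p) u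
  rw [mvfderiv_const] at h2
  refine h2.trans ?_
  rw [h1 u, mvfderiv_const]
  have e1 : g.coord p p (0 : E) = 0 := (g.coord p p).map_zero
  have e2 : g.coord p p a (0 : E) = 0 := (g.coord p p a).map_zero
  change (g.dcoord p u a + g.coord p p (0 : E)) b + g.coord p p a (0 : E) = _
  rw [e1, e2, add_zero, add_zero]

lemma dcoord_symm (p : N) (u a b : E) : g.dcoord p u a b = g.dcoord p u b a := by
  rw [← mvfderiv_coord_apply, ← mvfderiv_coord_apply]
  have h1 : (fun y ↦ g.coord p y a b) =ᶠ[𝓝 p] (fun y ↦ g.coord p y b a) := by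
    filter_upwards [chart_source_mem_nhds E p] with y hy using g.coord_symm hy _ _
  rw [mvfderiv_congr h1]

lemma two_val_christoffel (p : N) (u y z : E) :
    g.form p (g.christoffel p y u) z =
      (g.dcoord p u y z + g.dcoord p y u z - g.dcoord p z y u) / 2 := by
  rw [christoffel]
  refine (g.val_sharp p (koszul (g.dcoord p) y u) z).trans ?_
  rw [koszul_apply]

lemma christoffel_comm (p : N) (u y : E) : g.christoffel p y u = g.christoffel p u y := by
  have : koszul (g.dcoord p) y u = koszul (g.dcoord p) u y := by
    refine ContinuousLinearMap.ext fun z ↦ ?_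
    rw [koszul_apply, koszul_apply, g.dcoord_symm p z y u]
    ring
  exact congrArg (g.sharp p) this

lemma leviCivita_of_const {Y : ∀ x : N, TangentSpace 𝓘(ℝ, E) x} {p : N} {e : E}
    (h : (fun y ↦ comp p ⟨y, Y y⟩) =ᶠ[𝓝 p] fun _ ↦ e) (u : TangentSpace 𝓘(ℝ, E) p) :
    g.leviCivita Y p u = g.christoffel p (Y p) u := by
  change mvfderiv 𝓘(ℝ, E) (fun y ↦ comp p ⟨y, Y y⟩) p u + g.christoffel p (Y p) u = _
  rw [mvfderiv_congr h, mvfderiv_const]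
  exact zero_add _

lemma leviCivita_extend {p : N} (u v : TangentSpace 𝓘(ℝ, E) p) :
    g.leviCivita (FiberBundle.extend E v) p u = g.christoffel p v u := by
  have h1 : (fun y ↦ comp p ⟨y, FiberBundle.extend E v y⟩) =ᶠ[𝓝 p] fun _ ↦ comp p ⟨p, v⟩ := by
    filter_upwards [chart_source_mem_nhds E p] with y hy
    have hb : y ∈ (trivializationAt E (TangentSpace 𝓘(ℝ, E)) p).baseSet := by simpa using hy
    have h2 := (trivializationAt E (TangentSpace 𝓘(ℝ, E)) p).apply_mk_symm hb (comp p ⟨p, v⟩)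
    have h3 := congrArg Prod.snd h2
    exact h3
  rw [g.leviCivita_of_const h1, FiberBundle.extend_apply_self]

lemma lieBracketWithin_const (a b : E) (s : Set E) (x : E) :
    VectorField.lieBracketWithin ℝ (fun _ : E ↦ a) (fun _ : E ↦ b) s x = 0 := by
  simp [VectorField.lieBracketWithin]

lemma mlieBracket_extend {p : N} (u v : TangentSpace 𝓘(ℝ, E) p) :
    VectorField.mlieBracket 𝓘(ℝ, E) (FiberBundle.extend E u) (FiberBundle.extend E v) p = 0 := by
  have key : ∀ w : TangentSpace 𝓘(ℝ, E) p,
      VectorField.mpullbackWithin 𝓘(ℝ, E) 𝓘(ℝ, E) (extChartAt 𝓘(ℝ, E) p).symm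
        (FiberBundle.extend E w) (range 𝓘(ℝ, E)) =ᶠ[𝓝 (extChartAt 𝓘(ℝ, E) p p)]
        fun _ ↦ (w : E) := by
    intro w
    have hmem : (extChartAt 𝓘(ℝ, E) p).target ∈ 𝓝 (extChartAt 𝓘(ℝ, E) p p) :=
      extChartAt_target_mem_nhds p
    filter_upwards [hmem] with z hz
    have hs : (extChartAt 𝓘(ℝ, E) p).symm z ∈ (chartAt E p).source := by
      simpa using (extChartAt 𝓘(ℝ, E) p).map_target hz
    have h1 : FiberBundle.extend E w ((extChartAt 𝓘(ℝ, E) p).symm z) =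
        (trivializationAt E (TangentSpace 𝓘(ℝ, E)) p).symmL ℝ
          ((extChartAt 𝓘(ℝ, E) p).symm z) (comp p ⟨p, w⟩) := by
      rw [Trivialization.symmL_apply _ (by simpa using hs)]
      rfl
    rw [VectorField.mpullbackWithin_apply, h1, TangentBundle.symmL_trivializationAt hs, comp_self,
      (extChartAt 𝓘(ℝ, E) p).right_inv hz]
    have h2 := isInvertible_mfderivWithin_extChartAt_symm (I := 𝓘(ℝ, E)) hz
    exact h2.inverse_apply_eq.2 rfl
  rw [← VectorField.mlieBracketWithin_univ, VectorField.mlieBracketWithin_apply,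
    Filter.EventuallyEq.lieBracketWithin_vectorField_eq_nhds (key u) (key v)]
  have h0 := lieBracketWithin_const (E := E) u v
    ((extChartAt 𝓘(ℝ, E) p).symm ⁻¹' univ ∩ range 𝓘(ℝ, E)) (extChartAt 𝓘(ℝ, E) p p)
  exact (congrArg (mfderiv 𝓘(ℝ, E) 𝓘(ℝ, E) (extChartAt 𝓘(ℝ, E) p) p).inverse h0).trans (map_zero _)

/-- The Levi-Civita connection is torsion-free. -/
theorem leviCivita_torsion : (g.leviCivita).torsion = 0 := by
  have : CompleteSpace E := FiniteDimensional.complete ℝ E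
  funext p
  refine ContinuousLinearMap.ext fun u ↦ ContinuousLinearMap.ext fun v ↦ ?_
  rw [CovariantDerivative.torsion_apply_eq_extend, mlieBracket_extend, leviCivita_extend,
    leviCivita_extend]
  simp only [FiberBundle.extend_apply_self]
  have h := g.christoffel_comm p u v
  rw [sub_zero]
  exact sub_eq_zero.2 h

lemma coord_self (p : N) (u w : E) : g.coord p p u w = g.form p u w := by
  have h := g.coord_apply (mem_chart_source E p) (u : TangentSpace 𝓘(ℝ, E) p)
    (w : TangentSpace 𝓘(ℝ, E) p)
  have h1 : comp p ⟨p, (u : TangentSpace 𝓘(ℝ, E) p)⟩ = u := comp_self p u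
  have h2 : comp p ⟨p, (w : TangentSpace 𝓘(ℝ, E) p)⟩ = w := comp_self p w
  rw [h1, h2] at h
  exact h

lemma metric_aux (p : N) (a b y z v : E) :
    g.dcoord p v y z + g.coord p p a z + g.coord p p y b =
      g.form p (a + g.christoffel p y v) z + g.form p y (b + g.christoffel p z v) := by
  have hs : ∀ u w, g.form p u w = g.form p w u := g.symm p
  have e4 : g.form p (a + g.christoffel p y v) z = g.form p a z + g.form p (g.christoffel p y v) z :=
    congrArg (fun φ : E →L[ℝ] ℝ ↦ φ z) ((g.form p).map_add _ _)
  have e5 : g.form p y (b + g.christoffel p z v) = g.form p y b + g.form p y (g.christoffel p z v) :=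
    (g.form p y).map_add _ _
  rw [coord_self, coord_self, e4, e5, hs y (g.christoffel p z v), two_val_christoffel,
    two_val_christoffel, g.dcoord_symm p v z y, g.dcoord_symm p y z v, g.dcoord_symm p z y v]
  ring

/-- The Levi-Civita connection is metric. -/
theorem leviCivita_metric {Y Z : ∀ x : N, TangentSpace 𝓘(ℝ, E) x} {x : N}
    (hY : MDiffAt (T% Y) x) (hZ : MDiffAt (T% Z) x) (v : TangentSpace 𝓘(ℝ, E) x) :
    d% (fun y ↦ g.val y (Y y) (Z y)) x v =
      g.val x (g.leviCivita Y x v) (Z x) + g.val x (Y x) (g.leviCivita Z x v) := by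
  have h1 : (fun y ↦ g.val y (Y y) (Z y)) =ᶠ[𝓝 x]
      (fun y ↦ g.coord x y (comp x ⟨y, Y y⟩) (comp x ⟨y, Z y⟩)) := by
    filter_upwards [chart_source_mem_nhds E x] with y hy using (g.coord_apply hy _ _).symm
  have hY' := mdifferentiableAt_comp hY
  have hZ' := mdifferentiableAt_comp hZ
  have h0 : MDiffAt (fun y ↦ g.coord x y (comp x ⟨y, Y y⟩)) x :=
    (g.mdifferentiableAt_coord x).clm_apply hY'
  rw [mvfderiv_congr h1, mvfderiv_clm_apply h0 hZ',
    mvfderiv_clm_apply (g.mdifferentiableAt_coord x) hY', comp_self, comp_self]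
  exact g.metric_aux x _ _ _ _ v

end SemiRiemannianMetric

variable [FiniteDimensional ℝ E]

/-- `(N, g, J)` is an indefinite Kähler manifold: `g` has index `0 < q < dim N`, and `J` is a
smooth `(1,1)`-tensor field with `J² = -1`, `g(JX, JY) = g(X, Y)` and
`∇_v (J Y) = J (∇_v Y)` for the Levi-Civita connection. -/
structure IsIndefiniteKahler (g : SemiRiemannianMetric E N)
    (J : ∀ x : N, TangentSpace 𝓘(ℝ, E) x →L[ℝ] TangentSpace 𝓘(ℝ, E) x) : Prop where
  index_pos : 0 < g.index
  index_lt : g.index < Module.finrank ℝ E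
  contMDiff : ContMDiff 𝓘(ℝ, E) (𝓘(ℝ, E).prod 𝓘(ℝ, E →L[ℝ] E)) ∞
    (fun x ↦ TotalSpace.mk' (E →L[ℝ] E) x (J x))
  sq : ∀ x v, J x (J x v) = -v
  hermitian : ∀ x u v, g.val x (J x u) (J x v) = g.val x u v
  parallel : ∀ (x : N) (v : TangentSpace 𝓘(ℝ, E) x) (Y : ∀ y : N, TangentSpace 𝓘(ℝ, E) y),
    CMDiffAt ∞ (T% Y) x → g.leviCivita (fun y ↦ J y (Y y)) x v = J x (g.leviCivita Y x v)

end Ambient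

section Submanifold

variable {E : Type*} [NormedAddCommGroup E] [NormedSpace ℝ E] [FiniteDimensional ℝ E]
  {N : Type*} [TopologicalSpace N] [ChartedSpace E N] [IsManifold 𝓘(ℝ, E) ∞ N]
  {F : Type*} [NormedAddCommGroup F] [NormedSpace ℝ F] [FiniteDimensional ℝ F]
  {M : Type*} [TopologicalSpace M] [ChartedSpace F M] [IsManifold 𝓘(ℝ, F) ∞ M]

/-- The pullback of a connection on `TN` along `f : M → N`: for `v ∈ T_x M` and a section `Z` of
`TN` along `f`, this is `∇_v Z`. In the frame of coordinate vector fields of the preferred chart at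
`f x` it is `dZ(v) + ∇_{df v} Z₀`, where `Z₀` is the field with constant components equal to those
of `Z x`. -/
def pullbackDeriv (cov : CovariantDerivative 𝓘(ℝ, E) E (TangentSpace 𝓘(ℝ, E) : N → Type _))
    (f : M → N) (Z : ∀ x : M, TangentSpace 𝓘(ℝ, E) (f x)) (x : M) (v : TangentSpace 𝓘(ℝ, F) x) :
    TangentSpace 𝓘(ℝ, E) (f x) :=
  (mvfderiv 𝓘(ℝ, F) (fun y ↦ comp (f x) ⟨f y, Z y⟩) x v : E) +
    (show E from cov (FiberBundle.extend E (Z x)) (f x) (mfderiv 𝓘(ℝ, F) 𝓘(ℝ, E) f x v))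

/-- The section `df ∘ X` of `TN` along `f`. -/
def push (f : M → N) (X : ∀ x : M, TangentSpace 𝓘(ℝ, F) x) (x : M) :
    TangentSpace 𝓘(ℝ, E) (f x) :=
  mfderiv 𝓘(ℝ, F) 𝓘(ℝ, E) f x (X x)

/-- `W` is a smooth vector subbundle of `TN` along `f`: near every point it has a smooth local
frame. -/
def IsSubbundle (f : M → N) (W : ∀ x : M, Submodule ℝ (TangentSpace 𝓘(ℝ, E) (f x))) : Prop :=
  ∀ x₀ : M, ∃ (k : ℕ) (s : Fin k → ∀ x : M, TangentSpace 𝓘(ℝ, E) (f x)), ∃ U ∈ 𝓝 x₀,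
    (∀ i, ContMDiffOn 𝓘(ℝ, F) 𝓘(ℝ, E).tangent ∞
      (fun x ↦ (⟨f x, s i x⟩ : TangentBundle 𝓘(ℝ, E) N)) U) ∧
    ∀ x ∈ U, LinearIndependent ℝ (fun i ↦ s i x) ∧ Submodule.span ℝ (range fun i ↦ s i x) = W x

/-- `TM`, as a family of subspaces of `TN` along `f`. -/
def tangentSub (F : Type*) [NormedAddCommGroup F] [NormedSpace ℝ F]
    {M : Type*} [TopologicalSpace M] [ChartedSpace F M] (f : M → N) (x : M) :
    Submodule ℝ (TangentSpace 𝓘(ℝ, E) (f x)) :=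
  LinearMap.range (mfderiv 𝓘(ℝ, F) 𝓘(ℝ, E) f x).toLinearMap

/-- The orthogonal complement of a subspace of `T_p N`. -/
def SemiRiemannianMetric.perp (g : SemiRiemannianMetric E N) {p : N}
    (W : Submodule ℝ (TangentSpace 𝓘(ℝ, E) p)) : Submodule ℝ (TangentSpace 𝓘(ℝ, E) p) where
  carrier := {u | ∀ v ∈ W, g.val p u v = 0}
  add_mem' hu hv w hw := by simp [hu w hw, hv w hw]
  zero_mem' := by simp
  smul_mem' c u hu w hw := by simp [hu w hw]

/-- The radical `Rad(TM) = TM ∩ TM^⊥`. -/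
def rad (g : SemiRiemannianMetric E N) (F : Type*) [NormedAddCommGroup F] [NormedSpace ℝ F]
    {M : Type*} [TopologicalSpace M] [ChartedSpace F M] (f : M → N) (x : M) :
    Submodule ℝ (TangentSpace 𝓘(ℝ, E) (f x)) :=
  tangentSub F f x ⊓ g.perp (tangentSub F f x)

/-- An `r`-lightlike submanifold `(M, S(TM), S(TM^⊥), ltr(TM))` of `(N, g)`: `f : M → N` is an
immersion whose radical has constant rank `r ≥ 1`, `screen` is a screen distribution `S(TM)`,
`coscreen` is a screen transversal bundle `S(TM^⊥)`, and `ltr` is a lightlike transversal bundle: an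
isotropic complement of `Rad(TM)` in the orthogonal complement of `S(TM) ⊥ S(TM^⊥)`. -/
structure LightlikeSubmanifold (g : SemiRiemannianMetric E N) (f : M → N) (r : ℕ) where
  immersion : Manifold.IsImmersion 𝓘(ℝ, F) 𝓘(ℝ, E) ∞ f
  one_le_rank : 1 ≤ r
  finrank_rad : ∀ x, Module.finrank ℝ (rad g F f x) = r
  screen : ∀ x : M, Submodule ℝ (TangentSpace 𝓘(ℝ, E) (f x))
  screen_subbundle : IsSubbundle (F := F) f screen
  screen_sup_rad : ∀ x, screen x ⊔ rad g F f x = tangentSub F f x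
  screen_inf_rad : ∀ x, screen x ⊓ rad g F f x = ⊥
  screen_nondegenerate : ∀ x, screen x ⊓ g.perp (screen x) = ⊥
  coscreen : ∀ x : M, Submodule ℝ (TangentSpace 𝓘(ℝ, E) (f x))
  coscreen_subbundle : IsSubbundle (F := F) f coscreen
  coscreen_sup_rad : ∀ x, coscreen x ⊔ rad g F f x = g.perp (tangentSub F f x)
  coscreen_inf_rad : ∀ x, coscreen x ⊓ rad g F f x = ⊥
  coscreen_nondegenerate : ∀ x, coscreen x ⊓ g.perp (coscreen x) = ⊥
  ltr : ∀ x : M, Submodule ℝ (TangentSpace 𝓘(ℝ, E) (f x))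
  ltr_subbundle : IsSubbundle (F := F) f ltr
  rad_sup_ltr : ∀ x, rad g F f x ⊔ ltr x = g.perp (screen x ⊔ coscreen x)
  rad_inf_ltr : ∀ x, rad g F f x ⊓ ltr x = ⊥
  ltr_isotropic : ∀ x, ∀ u ∈ ltr x, ∀ v ∈ ltr x, g.val (f x) u v = 0

lemma SemiRiemannianMetric.sup_perp (g : SemiRiemannianMetric E N) {p : N}
    {W : Submodule ℝ (TangentSpace 𝓘(ℝ, E) p)} (hW : W ⊓ g.perp W = ⊥) : W ⊔ g.perp W = ⊤ := by
  have : FiniteDimensional ℝ (TangentSpace 𝓘(ℝ, E) p) := inferInstanceAs (FiniteDimensional ℝ E)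
  let B : LinearMap.BilinForm ℝ (TangentSpace 𝓘(ℝ, E) p) :=
    LinearMap.mk₂ ℝ (fun u v ↦ g.val p u v) (by simp) (by simp) (by simp) (by simp)
  have hB : B.IsRefl := fun u v h ↦ (g.symm p v u).trans h
  have hperp : B.orthogonal W = g.perp W := by
    ext u
    rw [LinearMap.BilinForm.mem_orthogonal_iff]
    exact ⟨fun h v hv ↦ (g.symm p u v).trans (h v hv), fun h v hv ↦ (g.symm p v u).trans (h v hv)⟩
  have h := (LinearMap.BilinForm.isCompl_orthogonal_iff_disjoint hB (W := W)).2
    (by rw [hperp]; exact disjoint_iff.2 hW)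
  rw [hperp] at h
  exact h.sup_eq_top

namespace LightlikeSubmanifold

variable {g : SemiRiemannianMetric E N} {f : M → N} {r : ℕ}
  (Λ : LightlikeSubmanifold (F := F) g f r)

/-- The transversal vector bundle `tr(TM) = ltr(TM) ⊥ S(TM^⊥)`. -/
def tr (x : M) : Submodule ℝ (TangentSpace 𝓘(ℝ, E) (f x)) := Λ.ltr x ⊔ Λ.coscreen x

lemma screen_perp_coscreen (x : M) {a c : TangentSpace 𝓘(ℝ, E) (f x)} (ha : a ∈ Λ.screen x)
    (hc : c ∈ Λ.coscreen x) : g.val (f x) c a = 0 := by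
  have h1 : c ∈ g.perp (tangentSub F f x) := Λ.coscreen_sup_rad x ▸ Submodule.mem_sup_left hc
  have h2 : a ∈ tangentSub F f x := Λ.screen_sup_rad x ▸ Submodule.mem_sup_left ha
  exact h1 a h2

lemma nondegenerate_sup (x : M) :
    (Λ.screen x ⊔ Λ.coscreen x) ⊓ g.perp (Λ.screen x ⊔ Λ.coscreen x) = ⊥ := by
  rw [eq_bot_iff]
  rintro u ⟨hu, hp⟩
  obtain ⟨a, ha, c, hc, rfl⟩ := Submodule.mem_sup.1 hu
  have ha0 : a = 0 := by
    have : a ∈ Λ.screen x ⊓ g.perp (Λ.screen x) := by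
      refine ⟨ha, fun v hv ↦ ?_⟩
      have h := hp v (Submodule.mem_sup_left hv)
      simpa [Λ.screen_perp_coscreen x hv hc] using h
    simpa [Λ.screen_nondegenerate x] using this
  have hc0 : c = 0 := by
    have : c ∈ Λ.coscreen x ⊓ g.perp (Λ.coscreen x) := by
      refine ⟨hc, fun v hv ↦ ?_⟩
      have h := hp v (Submodule.mem_sup_right hv)
      simpa [ha0] using h
    simpa [Λ.coscreen_nondegenerate x] using this
  simp [ha0, hc0]

/-- `TN = TM ⊕ tr(TM)` along `M`. -/
lemma isCompl (x : M) : IsCompl (tangentSub F f x) (Λ.tr x) := by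
  refine IsCompl.of_eq ?_ ?_
  · rw [eq_bot_iff]
    rintro u ⟨hu, hp⟩
    rw [← Λ.screen_sup_rad x] at hu
    obtain ⟨a, ha, ρ, hρ, rfl⟩ := Submodule.mem_sup.1 hu
    obtain ⟨l, hl, c, hc, h⟩ := Submodule.mem_sup.1 hp
    have h1 : a - c = l - ρ := by
      rw [sub_eq_sub_iff_add_eq_add, ← h, add_comm]
    have h2 : a - c ∈ (Λ.screen x ⊔ Λ.coscreen x) ⊓ g.perp (Λ.screen x ⊔ Λ.coscreen x) := by
      refine ⟨Submodule.sub_mem _ (Submodule.mem_sup_left ha) (Submodule.mem_sup_right hc), ?_⟩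
      rw [h1, ← Λ.rad_sup_ltr x]
      exact Submodule.sub_mem _ (Submodule.mem_sup_right hl) (Submodule.mem_sup_left hρ)
    rw [Λ.nondegenerate_sup x, Submodule.mem_bot] at h2
    have h3 : ρ ∈ rad g F f x ⊓ Λ.ltr x := by
      refine ⟨hρ, ?_⟩
      rw [h2] at h1
      rwa [← sub_eq_zero.1 h1.symm]
    rw [Λ.rad_inf_ltr x, Submodule.mem_bot] at h3
    have h4 : a ∈ Λ.screen x ⊓ g.perp (Λ.screen x) := by
      refine ⟨ha, fun v hv ↦ ?_⟩
      rw [sub_eq_zero.1 h2]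
      exact Λ.screen_perp_coscreen x hv hc
    rw [Λ.screen_nondegenerate x, Submodule.mem_bot] at h4
    simp [h3, h4]
  · have h := g.sup_perp (Λ.nondegenerate_sup x)
    rw [← Λ.rad_sup_ltr x] at h
    rw [tr, ← Λ.screen_sup_rad x, ← h]
    ac_rfl

/-- The projection of `TN` onto `TM` along `tr(TM)`. -/
def tan (x : M) : TangentSpace 𝓘(ℝ, E) (f x) →ₗ[ℝ] TangentSpace 𝓘(ℝ, E) (f x) :=
  (tangentSub F f x).projection (Λ.tr x) (Λ.isCompl x)

/-- The ambient derivative `∇̄_X Z` of a section `Z` of `TN` along `M`, for a vector field `X`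
on `M`. -/
def ambientDeriv (_ : LightlikeSubmanifold (F := F) g f r) (X : ∀ x : M, TangentSpace 𝓘(ℝ, F) x)
    (Z : ∀ x : M, TangentSpace 𝓘(ℝ, E) (f x)) (x : M) : TangentSpace 𝓘(ℝ, E) (f x) :=
  pullbackDeriv g.leviCivita f Z x (X x)

/-- The induced connection: `∇_X Z` is the tangential part of `∇̄_X Z`, for `Z` tangent to `M`. -/
def induced (X : ∀ x : M, TangentSpace 𝓘(ℝ, F) x)
    (Z : ∀ x : M, TangentSpace 𝓘(ℝ, E) (f x)) (x : M) : TangentSpace 𝓘(ℝ, E) (f x) :=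
  Λ.tan x (Λ.ambientDeriv X Z x)

/-- The second fundamental form: `h(X, Z)` is the transversal part of `∇̄_X Z`, for `Z` tangent
to `M`. -/
def h (X : ∀ x : M, TangentSpace 𝓘(ℝ, F) x)
    (Z : ∀ x : M, TangentSpace 𝓘(ℝ, E) (f x)) (x : M) : TangentSpace 𝓘(ℝ, E) (f x) :=
  Λ.ambientDeriv X Z x - Λ.induced X Z x

/-- `B V` is the tangential part of `J V`, for transversal vectors `V`. -/
def B (J : ∀ y : N, TangentSpace 𝓘(ℝ, E) y →L[ℝ] TangentSpace 𝓘(ℝ, E) y) (x : M)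
    (V : TangentSpace 𝓘(ℝ, E) (f x)) : TangentSpace 𝓘(ℝ, E) (f x) :=
  Λ.tan x (J (f x) V)

/-- `X ∈ Γ(W)`: `X` is a smooth vector field on `M` with values in the distribution `W ⊆ TM`. -/
def IsSection (_ : LightlikeSubmanifold (F := F) g f r)
    (W : ∀ x : M, Submodule ℝ (TangentSpace 𝓘(ℝ, E) (f x)))
    (X : ∀ x : M, TangentSpace 𝓘(ℝ, F) x) : Prop :=
  CMDiff ∞ (T% X) ∧ ∀ x, push f X x ∈ W x

/-- The distribution `W ⊆ TM` defines a totally geodesic foliation on `M`: it is involutive, and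
`∇_X Y ∈ Γ(W)` for all `X, Y ∈ Γ(W)`, where `∇` is the induced connection. -/
def DefinesTotallyGeodesicFoliation
    (W : ∀ x : M, Submodule ℝ (TangentSpace 𝓘(ℝ, E) (f x))) : Prop :=
  (∀ X Y, Λ.IsSection W X → Λ.IsSection W Y →
    ∀ x, push (E := E) f (VectorField.mlieBracket 𝓘(ℝ, F) X Y) x ∈ W x) ∧
  (∀ X Y, Λ.IsSection W X → Λ.IsSection W Y → ∀ x, Λ.induced X (push f Y) x ∈ W x)

end LightlikeSubmanifold

/-- The image `J W` of a family of subspaces. -/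
def mapJ (J : ∀ y : N, TangentSpace 𝓘(ℝ, E) y →L[ℝ] TangentSpace 𝓘(ℝ, E) y) (f : M → N)
    (W : ∀ x : M, Submodule ℝ (TangentSpace 𝓘(ℝ, E) (f x))) (x : M) :
    Submodule ℝ (TangentSpace 𝓘(ℝ, E) (f x)) :=
  (W x).map (J (f x)).toLinearMap

/-- The data and conditions that make a lightlike submanifold of `(N, g, J)` a screen transversal
Cauchy-Riemann (STCR) lightlike submanifold:
`Rad(TM) = D₁ ⊕ D₂`, `J D₁ ⊆ S(TM)`, `J D₂ ⊆ S(TM^⊥)`,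
`S(TM) = {J D₁ ⊕ D'} ⊥ D₀`, `J D₀ = D₀`, `J D' = L₁ ⊥ S`, where `D₀` is nondegenerate,
`L₁ ⊆ ltr(TM)` and `S ⊆ S(TM^⊥)`. -/
structure STCR {g : SemiRiemannianMetric E N} {f : M → N} {r : ℕ}
    (J : ∀ y : N, TangentSpace 𝓘(ℝ, E) y →L[ℝ] TangentSpace 𝓘(ℝ, E) y)
    (Λ : LightlikeSubmanifold (F := F) g f r) where
  D₁ : ∀ x : M, Submodule ℝ (TangentSpace 𝓘(ℝ, E) (f x))
  D₂ : ∀ x : M, Submodule ℝ (TangentSpace 𝓘(ℝ, E) (f x))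
  D₁_subbundle : IsSubbundle (F := F) f D₁
  D₂_subbundle : IsSubbundle (F := F) f D₂
  D₁_sup_D₂ : ∀ x, D₁ x ⊔ D₂ x = rad g F f x
  D₁_inf_D₂ : ∀ x, D₁ x ⊓ D₂ x = ⊥
  map_D₁ : ∀ x, mapJ J f D₁ x ≤ Λ.screen x
  map_D₂ : ∀ x, mapJ J f D₂ x ≤ Λ.coscreen x
  D₀ : ∀ x : M, Submodule ℝ (TangentSpace 𝓘(ℝ, E) (f x))
  D' : ∀ x : M, Submodule ℝ (TangentSpace 𝓘(ℝ, E) (f x))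
  D₀_subbundle : IsSubbundle (F := F) f D₀
  D'_subbundle : IsSubbundle (F := F) f D'
  map_D₁_inf_D' : ∀ x, mapJ J f D₁ x ⊓ D' x = ⊥
  sup_inf_D₀ : ∀ x, (mapJ J f D₁ x ⊔ D' x) ⊓ D₀ x = ⊥
  sup_sup_D₀ : ∀ x, mapJ J f D₁ x ⊔ D' x ⊔ D₀ x = Λ.screen x
  sup_perp_D₀ : ∀ x, ∀ u ∈ mapJ J f D₁ x ⊔ D' x, ∀ v ∈ D₀ x, g.val (f x) u v = 0
  D₀_nondegenerate : ∀ x, D₀ x ⊓ g.perp (D₀ x) = ⊥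
  map_D₀ : ∀ x, mapJ J f D₀ x = D₀ x
  L₁ : ∀ x : M, Submodule ℝ (TangentSpace 𝓘(ℝ, E) (f x))
  S : ∀ x : M, Submodule ℝ (TangentSpace 𝓘(ℝ, E) (f x))
  L₁_subbundle : IsSubbundle (F := F) f L₁
  S_subbundle : IsSubbundle (F := F) f S
  L₁_le : ∀ x, L₁ x ≤ Λ.ltr x
  S_le : ∀ x, S x ≤ Λ.coscreen x
  L₁_inf_S : ∀ x, L₁ x ⊓ S x = ⊥
  L₁_perp_S : ∀ x, ∀ u ∈ L₁ x, ∀ v ∈ S x, g.val (f x) u v = 0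
  map_D' : ∀ x, mapJ J f D' x = L₁ x ⊔ S x

/-- The distribution `D = D₀ ⊕ D₁ ⊕ J D₁`. -/
def STCR.D {g : SemiRiemannianMetric E N} {f : M → N} {r : ℕ}
    {J : ∀ y : N, TangentSpace 𝓘(ℝ, E) y →L[ℝ] TangentSpace 𝓘(ℝ, E) y}
    {Λ : LightlikeSubmanifold (F := F) g f r} (σ : STCR J Λ) (x : M) :
    Submodule ℝ (TangentSpace 𝓘(ℝ, E) (f x)) :=
  σ.D₀ x ⊔ σ.D₁ x ⊔ mapJ J f σ.D₁ x

end Submanifold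
end LightlikeGeometry

end

/-! Since `J` is parallel, `∇̄_X (JY) = J ∇̄_X Y`. Applying `J` once more and taking tangential
parts gives `B h(X, JY) = -∇_X Y - tan (J ∇_X JY)`, where `tan` is the projection onto `TM` along
`tr(TM)`.

Two pointwise facts turn this identity into the equivalence. First, `tan ∘ J` maps all of `TM` into
`D` (`STCR.tan_J_mem_D`): `J` preserves `D` and sends `D'` and `D₂` into the transversal bundle. So
`∇_X Y` lies in `D` exactly when `B h(X, JY)` does. Second, a vector `B V` with `V` transversal lies
in `D` only if it vanishes (`STCR.B_eq_zero_of_mem_D`): `B V` is orthogonal to `D₀`, `L₁` and `J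
L₁`, and these together separate the vectors of `D`. Hence `B h(X, JY) = 0` if and only if `∇_X Y ∈
D` (`STCR.B_h_J_eq_zero_iff`).

Involutivity is then automatic, because the induced connection is torsion-free
(`LightlikeSubmanifold.induced_push_sub`).

The analytic input is that the Levi-Civita connection, pulled back along `f`, is still torsion-free
and still commutes with `J` (`pullbackDeriv_push_sub`, `IsIndefiniteKahler.pullbackDeriv_J`). Both
are checked in the chart at `f x`. -/

namespace LightlikeGeometry

/-! ### Linear algebra in a single tangent space -/

section Pointwise

variable {E : Type*} [NormedAddCommGroup E] [NormedSpace ℝ E] [FiniteDimensional ℝ E]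
  {N : Type*} [TopologicalSpace N] [ChartedSpace E N] [IsManifold 𝓘(ℝ, E) ∞ N]
  {F : Type*} [NormedAddCommGroup F] [NormedSpace ℝ F] [FiniteDimensional ℝ F]
  {M : Type*} [TopologicalSpace M] [ChartedSpace F M] [IsManifold 𝓘(ℝ, F) ∞ M]
  {g : SemiRiemannianMetric E N}
  {J : ∀ y : N, TangentSpace 𝓘(ℝ, E) y →L[ℝ] TangentSpace 𝓘(ℝ, E) y}
  {f : M → N} {r : ℕ}

lemma IsIndefiniteKahler.val_J_left (hJ : IsIndefiniteKahler g J) (y : N)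
    (u v : TangentSpace 𝓘(ℝ, E) y) : g.val y (J y u) v = -g.val y u (J y v) := by
  rw [← hJ.hermitian y (J y u) v, hJ.sq]
  simp

namespace LightlikeSubmanifold

variable (Λ : LightlikeSubmanifold (F := F) g f r) (x : M)

lemma screen_le_tangentSub : Λ.screen x ≤ tangentSub F f x :=
  Λ.screen_sup_rad x ▸ le_sup_left

lemma ltr_perp_sup {l u : TangentSpace 𝓘(ℝ, E) (f x)} (hl : l ∈ Λ.ltr x)
    (hu : u ∈ Λ.screen x ⊔ Λ.coscreen x) : g.val (f x) l u = 0 := by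
  have h : l ∈ g.perp (Λ.screen x ⊔ Λ.coscreen x) :=
    Λ.rad_sup_ltr x ▸ Submodule.mem_sup_right hl
  exact h u hu

lemma tr_perp_screen {v a : TangentSpace 𝓘(ℝ, E) (f x)} (hv : v ∈ Λ.tr x)
    (ha : a ∈ Λ.screen x) : g.val (f x) v a = 0 := by
  obtain ⟨l, hl, c, hc, rfl⟩ := Submodule.mem_sup.1 hv
  simp [Λ.ltr_perp_sup x hl (Submodule.mem_sup_left ha), Λ.screen_perp_coscreen x ha hc]

/-- The `ltr` part of `v` pairs to zero with `l` by isotropy, the coscreen part because `ltr` lies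
in the orthogonal complement of the coscreen. Together with `tr_perp_screen` this supplies the test
vectors against which transversal vectors are invisible. -/
lemma tr_perp_ltr {v l : TangentSpace 𝓘(ℝ, E) (f x)} (hv : v ∈ Λ.tr x)
    (hl : l ∈ Λ.ltr x) : g.val (f x) v l = 0 := by
  obtain ⟨l', hl', c, hc, rfl⟩ := Submodule.mem_sup.1 hv
  have h := Λ.ltr_perp_sup x hl (Submodule.mem_sup_right hc)
  rw [g.symm] at h
  simp [Λ.ltr_isotropic x l' hl' l hl, h]

lemma tan_mem (u : TangentSpace 𝓘(ℝ, E) (f x)) : Λ.tan x u ∈ tangentSub F f x :=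
  Submodule.projection_apply_mem (Λ.isCompl x) u

lemma tan_eq_self {u : TangentSpace 𝓘(ℝ, E) (f x)} (hu : u ∈ tangentSub F f x) :
    Λ.tan x u = u :=
  Submodule.projection_apply_left (Λ.isCompl x) ⟨u, hu⟩

lemma tan_eq_zero {u : TangentSpace 𝓘(ℝ, E) (f x)} (hu : u ∈ Λ.tr x) : Λ.tan x u = 0 :=
  (Submodule.projection_apply_eq_zero_iff (Λ.isCompl x)).2 hu

lemma sub_tan_mem (u : TangentSpace 𝓘(ℝ, E) (f x)) : u - Λ.tan x u ∈ Λ.tr x := by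
  refine (Submodule.projection_apply_eq_zero_iff (Λ.isCompl x)).1 ?_
  change Λ.tan x (u - Λ.tan x u) = 0
  rw [map_sub, Λ.tan_eq_self x (Λ.tan_mem x u), sub_self]

end LightlikeSubmanifold

namespace STCR

variable {Λ : LightlikeSubmanifold (F := F) g f r} (σ : STCR J Λ) (x : M)

lemma D₁_le_rad : σ.D₁ x ≤ rad g F f x := σ.D₁_sup_D₂ x ▸ le_sup_left

lemma D₀_le_screen : σ.D₀ x ≤ Λ.screen x := σ.sup_sup_D₀ x ▸ le_sup_right

lemma D'_le_screen : σ.D' x ≤ Λ.screen x :=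
  σ.sup_sup_D₀ x ▸ le_sup_right.trans le_sup_left

lemma D_le_tangentSub : σ.D x ≤ tangentSub F f x :=
  sup_le (sup_le ((σ.D₀_le_screen x).trans (Λ.screen_le_tangentSub x))
    ((σ.D₁_le_rad x).trans inf_le_left)) ((σ.map_D₁ x).trans (Λ.screen_le_tangentSub x))

lemma J_mem_tr_of_mem_D' {u : TangentSpace 𝓘(ℝ, E) (f x)} (hu : u ∈ σ.D' x) :
    J (f x) u ∈ Λ.tr x := by
  have h : J (f x) u ∈ σ.L₁ x ⊔ σ.S x := σ.map_D' x ▸ Submodule.mem_map_of_mem hu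
  exact sup_le_sup (σ.L₁_le x) (σ.S_le x) h

lemma J_mem_D (hJ : IsIndefiniteKahler g J) {u : TangentSpace 𝓘(ℝ, E) (f x)} (hu : u ∈ σ.D x) :
    J (f x) u ∈ σ.D x := by
  obtain ⟨v, hv, w, hw, rfl⟩ := Submodule.mem_sup.1 hu
  obtain ⟨d, hd, a, ha, rfl⟩ := Submodule.mem_sup.1 hv
  obtain ⟨b, hb, rfl⟩ := hw
  have h1 : J (f x) d ∈ σ.D x := Submodule.mem_sup_left (Submodule.mem_sup_left
    (σ.map_D₀ x ▸ Submodule.mem_map_of_mem hd))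
  have h2 : J (f x) a ∈ σ.D x := Submodule.mem_sup_right (Submodule.mem_map_of_mem ha)
  have h3 : J (f x) (J (f x) b) ∈ σ.D x := by
    rw [hJ.sq]
    exact Submodule.neg_mem _ (Submodule.mem_sup_left (Submodule.mem_sup_right hb))
  have h4 := Submodule.add_mem _ (Submodule.add_mem _ h1 h2) h3
  rw [← map_add, ← map_add] at h4
  exact h4

/-- By linearity it suffices to treat the five summands `J D₁`, `D'`, `D₀`, `D₁`, `D₂` of `TM`.
Three of them lie in `D`, which `J` preserves; on `D'` and `D₂` the values of `J` are transversal,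
so the projection kills them. -/
lemma tan_J_mem_D (hJ : IsIndefiniteKahler g J) {u : TangentSpace 𝓘(ℝ, E) (f x)}
    (hu : u ∈ tangentSub F f x) : Λ.tan x (J (f x) u) ∈ σ.D x := by
  have hD : ∀ v ∈ σ.D x, Λ.tan x (J (f x) v) ∈ σ.D x := fun v hv ↦ by
    rw [Λ.tan_eq_self x (σ.D_le_tangentSub x (σ.J_mem_D x hJ hv))]
    exact σ.J_mem_D x hJ hv
  have hle : tangentSub F f x ≤
      (σ.D x).comap (Λ.tan x ∘ₗ (J (f x)).toLinearMap) := by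
    rw [← Λ.screen_sup_rad x, ← σ.sup_sup_D₀ x, ← σ.D₁_sup_D₂ x]
    refine sup_le (sup_le (sup_le ?_ ?_) ?_) (sup_le ?_ ?_)
    · exact fun v hv ↦ hD v (Submodule.mem_sup_right hv)
    · intro v hv
      change Λ.tan x (J (f x) v) ∈ σ.D x
      rw [Λ.tan_eq_zero x (σ.J_mem_tr_of_mem_D' x hv)]
      exact Submodule.zero_mem _
    · exact fun v hv ↦ hD v (Submodule.mem_sup_left (Submodule.mem_sup_left hv))
    · exact fun v hv ↦ hD v (Submodule.mem_sup_left (Submodule.mem_sup_right hv))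
    · intro v hv
      change Λ.tan x (J (f x) v) ∈ σ.D x
      have hJv : J (f x) v ∈ Λ.tr x :=
        Submodule.mem_sup_right (σ.map_D₂ x (Submodule.mem_map_of_mem hv))
      rw [Λ.tan_eq_zero x hJv]
      exact Submodule.zero_mem _
  exact hle hu

/-- `L₁` separates the vectors of `D₁`. -/
lemma eq_zero_of_perp_L₁ (hJ : IsIndefiniteKahler g J) {b : TangentSpace 𝓘(ℝ, E) (f x)}
    (hb : b ∈ σ.D₁ x) (h : ∀ l ∈ σ.L₁ x, g.val (f x) b l = 0) : b = 0 := by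
  have hJb : J (f x) b ∈ mapJ J f σ.D₁ x := Submodule.mem_map_of_mem hb
  have hrad := σ.D₁_le_rad x hb
  -- It is enough that `J b` is orthogonal to the whole screen, which is nondegenerate. Against `J
  -- D₁` this holds because `D₁` lies in the radical, and against `D₀` by the orthogonal splitting.
  -- Against `c ∈ D'` the pairing is `-g(b, J c)` with `J c ∈ L₁ ⊔ S`; the `L₁` part vanishes by
  -- hypothesis, the `S` part because `S` is normal to `M`.
  have hperp : J (f x) b ∈ Λ.screen x ⊓ g.perp (Λ.screen x) := by
    refine ⟨σ.map_D₁ x hJb, fun v hv ↦ ?_⟩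
    rw [← σ.sup_sup_D₀ x] at hv
    obtain ⟨w, hw, d, hd, rfl⟩ := Submodule.mem_sup.1 hv
    obtain ⟨_, ⟨a, ha, rfl⟩, c, hc, rfl⟩ := Submodule.mem_sup.1 hw
    have h1 : g.val (f x) (J (f x) b) (J (f x) a) = 0 := by
      rw [hJ.hermitian]
      exact hrad.2 a (σ.D₁_le_rad x ha).1
    have h2 : g.val (f x) (J (f x) b) c = 0 := by
      have hc' : J (f x) c ∈ σ.L₁ x ⊔ σ.S x := σ.map_D' x ▸ Submodule.mem_map_of_mem hc
      obtain ⟨l, hl, s, hs, hls⟩ := Submodule.mem_sup.1 hc'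
      have hs' : s ∈ g.perp (tangentSub F f x) :=
        Λ.coscreen_sup_rad x ▸ Submodule.mem_sup_left (σ.S_le x hs)
      rw [hJ.val_J_left, ← hls, map_add, h l hl, g.symm, hs' b hrad.1]
      simp
    have h3 : g.val (f x) (J (f x) b) d = 0 :=
      σ.sup_perp_D₀ x _ (Submodule.mem_sup_left hJb) d hd
    rw [map_add, map_add, h3]
    change g.val (f x) (J (f x) b) (J (f x) a) + _ + 0 = 0
    rw [h1, h2]
    simp
  rw [Λ.screen_nondegenerate x, Submodule.mem_bot] at hperp
  have h := hJ.sq (f x) b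
  rw [hperp, map_zero] at h
  exact neg_eq_zero.1 h.symm

/-- `J L₁ ⊆ S(TM)`. -/
lemma J_mem_screen_of_mem_L₁ (hJ : IsIndefiniteKahler g J) {l : TangentSpace 𝓘(ℝ, E) (f x)}
    (hl : l ∈ σ.L₁ x) : J (f x) l ∈ Λ.screen x := by
  have h : l ∈ mapJ J f σ.D' x := σ.map_D' x ▸ Submodule.mem_sup_left hl
  obtain ⟨c, hc, hcl⟩ := h
  change J (f x) c = l at hcl
  rw [← hcl, hJ.sq]
  exact Submodule.neg_mem _ (σ.D'_le_screen x hc)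

/-- `B V` has no nonzero values in `D`. -/
lemma B_eq_zero_of_mem_D (hJ : IsIndefiniteKahler g J) {V : TangentSpace 𝓘(ℝ, E) (f x)}
    (hV : V ∈ Λ.tr x) (hB : Λ.B J x V ∈ σ.D x) : Λ.B J x V = 0 := by
  set C := J (f x) V - Λ.tan x (J (f x) V) with hC
  have hCtr : C ∈ Λ.tr x := Λ.sub_tan_mem x _
  have hBV : Λ.B J x V = J (f x) V - C := by
    rw [hC, sub_sub_cancel]; rfl
  -- Both terms on the right pair a transversal vector, `V` or `C`, with `J w` or `w`. They vanish
  -- once `w` and `J w` both lie in the screen or in `ltr`, which holds for `w` in `L₁`, `J L₁` and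
  -- `D₀`.
  have hval : ∀ w, g.val (f x) (Λ.B J x V) w =
      -g.val (f x) V (J (f x) w) - g.val (f x) C w := fun w ↦ by
    rw [hBV, map_sub, ← hJ.val_J_left]; rfl
  have hL : ∀ l ∈ σ.L₁ x, g.val (f x) (Λ.B J x V) l = 0 := fun l hl ↦ by
    rw [hval, Λ.tr_perp_screen x hV (σ.J_mem_screen_of_mem_L₁ x hJ hl),
      Λ.tr_perp_ltr x hCtr (σ.L₁_le x hl)]
    simp
  have hJL : ∀ l ∈ σ.L₁ x, g.val (f x) (Λ.B J x V) (J (f x) l) = 0 := fun l hl ↦ by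
    rw [hval, hJ.sq, Λ.tr_perp_screen x hCtr (σ.J_mem_screen_of_mem_L₁ x hJ hl), map_neg,
      Λ.tr_perp_ltr x hV (σ.L₁_le x hl)]
    simp
  have hD₀ : ∀ d ∈ σ.D₀ x, g.val (f x) (Λ.B J x V) d = 0 := fun d hd ↦ by
    have hJd : J (f x) d ∈ σ.D₀ x := σ.map_D₀ x ▸ Submodule.mem_map_of_mem hd
    rw [hval, Λ.tr_perp_screen x hV (σ.D₀_le_screen x hJd),
      Λ.tr_perp_screen x hCtr (σ.D₀_le_screen x hd)]
    simp
  obtain ⟨v, hv, w, ⟨b, hb, hbw⟩, hsum⟩ := Submodule.mem_sup.1 hB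
  obtain ⟨d, hd, a, ha, rfl⟩ := Submodule.mem_sup.1 hv
  change J (f x) b = w at hbw
  subst hbw
  rw [← hsum] at hL hJL hD₀ ⊢
  have hJb : J (f x) b ∈ mapJ J f σ.D₁ x := Submodule.mem_map_of_mem hb
  -- The three components of `B V = d + a + J b` are removed in turn. Pairing with `D₀` isolates
  -- `d`, since `a` is radical and `J b` is orthogonal to `D₀`.
  have hd0 : d = 0 := by
    have h : d ∈ σ.D₀ x ⊓ g.perp (σ.D₀ x) := by
      refine ⟨hd, fun e he ↦ ?_⟩
      have h1 := hD₀ e he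
      have h2 : g.val (f x) a e = 0 :=
        (σ.D₁_le_rad x ha).2 e (Λ.screen_le_tangentSub x (σ.D₀_le_screen x he))
      have h3 : g.val (f x) (J (f x) b) e = 0 :=
        σ.sup_perp_D₀ x _ (Submodule.mem_sup_left hJb) e he
      simpa [h2, h3] using h1
    simpa [σ.D₀_nondegenerate x] using h
  subst hd0
  -- Pairing with `J l` kills the radical vector `a` and leaves `g(J b, J l) = g(b, l)`; what then
  -- remains is `a`, tested directly against `L₁`.
  have hb0 : b = 0 := by
    refine σ.eq_zero_of_perp_L₁ x hJ hb fun l hl ↦ ?_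
    have h1 := hJL l hl
    have h2 : g.val (f x) a (J (f x) l) = 0 :=
      (σ.D₁_le_rad x ha).2 _ (Λ.screen_le_tangentSub x (σ.J_mem_screen_of_mem_L₁ x hJ hl))
    simpa [h2, hJ.hermitian] using h1
  subst hb0
  have ha0 : a = 0 :=
    σ.eq_zero_of_perp_L₁ x hJ ha fun l hl ↦ by simpa using hL l hl
  simp [ha0]

end STCR

end Pointwise

/-! ### Lie brackets and second derivatives in a chart -/

section Coordinates

variable {E : Type*} [NormedAddCommGroup E] [NormedSpace ℝ E]
  {N : Type*} [TopologicalSpace N] [ChartedSpace E N] [IsManifold 𝓘(ℝ, E) ∞ N]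

/-- This links the components given by the bundle trivialization with the derivative of the chart,
so that the chain rule applies to them. -/
lemma comp_eq_mfderiv {p y : N} (hy : y ∈ (chartAt E p).source) (v : TangentSpace 𝓘(ℝ, E) y) :
    comp p ⟨y, v⟩ = mfderiv 𝓘(ℝ, E) 𝓘(ℝ, E) (extChartAt 𝓘(ℝ, E) p) y v := by
  have h := TangentBundle.continuousLinearMapAt_trivializationAt (I := 𝓘(ℝ, E)) hy
  have h2 : (trivializationAt E (TangentSpace 𝓘(ℝ, E)) p).continuousLinearMapAt ℝ y v =
      mfderiv 𝓘(ℝ, E) 𝓘(ℝ, E) (extChartAt 𝓘(ℝ, E) p) y v := by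
    rw [h]; rfl
  rw [Trivialization.continuousLinearMapAt_apply, Trivialization.linearMapAt_apply,
    if_pos (by simpa using hy)] at h2
  exact h2

lemma mpullbackWithin_extChartAt_symm (Y : ∀ x : N, TangentSpace 𝓘(ℝ, E) x) (p : N) :
    VectorField.mpullbackWithin 𝓘(ℝ, E) 𝓘(ℝ, E) (extChartAt 𝓘(ℝ, E) p).symm Y (range 𝓘(ℝ, E))
      =ᶠ[𝓝 (extChartAt 𝓘(ℝ, E) p p)]
        fun z ↦ comp p ⟨(extChartAt 𝓘(ℝ, E) p).symm z, Y ((extChartAt 𝓘(ℝ, E) p).symm z)⟩ := by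
  filter_upwards [extChartAt_target_mem_nhds (I := 𝓘(ℝ, E)) p] with z hz
  have hs : (extChartAt 𝓘(ℝ, E) p).symm z ∈ (chartAt E p).source := by
    simpa using (extChartAt 𝓘(ℝ, E) p).map_target hz
  have h2 := isInvertible_mfderivWithin_extChartAt_symm (I := 𝓘(ℝ, E)) hz
  rw [VectorField.mpullbackWithin_apply]
  refine h2.inverse_apply_eq.2 ?_
  rw [comp_eq_mfderiv hs]
  have h3 := mfderivWithin_extChartAt_symm_comp_mfderiv_extChartAt' (I := 𝓘(ℝ, E))
    ((extChartAt 𝓘(ℝ, E) p).map_target hz)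
  rw [(extChartAt 𝓘(ℝ, E) p).right_inv hz] at h3
  exact (congrArg (fun L ↦ L (Y ((extChartAt 𝓘(ℝ, E) p).symm z))) h3).symm

/-- The Lie bracket in coordinates. -/
lemma mlieBracket_eq_comp {X Y : ∀ x : N, TangentSpace 𝓘(ℝ, E) x} {p : N}
    (hX : MDiffAt (T% X) p) (hY : MDiffAt (T% Y) p) :
    VectorField.mlieBracket 𝓘(ℝ, E) X Y p =
      mvfderiv 𝓘(ℝ, E) (fun y ↦ comp p ⟨y, Y y⟩) p (X p) -
        mvfderiv 𝓘(ℝ, E) (fun y ↦ comp p ⟨y, X y⟩) p (Y p) := by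
  rw [← VectorField.mlieBracketWithin_univ, VectorField.mlieBracketWithin_apply,
    Filter.EventuallyEq.lieBracketWithin_vectorField_eq_nhds
      (mpullbackWithin_extChartAt_symm X p) (mpullbackWithin_extChartAt_symm Y p),
    mfderiv_extChartAt_self, (mdifferentiableAt_comp hX).mvfderiv,
    (mdifferentiableAt_comp hY).mvfderiv]
  have h0 : (extChartAt 𝓘(ℝ, E) p).symm (extChartAt 𝓘(ℝ, E) p p) = p := extChartAt_to_inv p
  have hid : (ContinuousLinearMap.id ℝ (TangentSpace 𝓘(ℝ, E) p)).inverse =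
    ContinuousLinearMap.id ℝ (TangentSpace 𝓘(ℝ, E) p) := ContinuousLinearMap.inverse_id
  simp only [VectorField.lieBracketWithin, preimage_univ, univ_inter]
  rw [h0, comp_self, comp_self]
  exact congrArg (fun L : E →L[ℝ] E ↦ L _) hid

variable {G : Type*} [NormedAddCommGroup G] [NormedSpace ℝ G]

/-- A vector-valued function satisfies `X (Y u) - Y (X u) = [X, Y] u`. -/
lemma mvfderiv_mlieBracket {u : N → G} {X Y : ∀ x : N, TangentSpace 𝓘(ℝ, E) x} {p : N}
    (hu : CMDiffAt 2 u p) (hX : MDiffAt (T% X) p) (hY : MDiffAt (T% Y) p) :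
    mvfderiv 𝓘(ℝ, E) u p (VectorField.mlieBracket 𝓘(ℝ, E) X Y p) =
      mvfderiv 𝓘(ℝ, E) (fun y ↦ mvfderiv 𝓘(ℝ, E) u y (Y y)) p (X p) -
        mvfderiv 𝓘(ℝ, E) (fun y ↦ mvfderiv 𝓘(ℝ, E) u y (X y)) p (Y p) := by
  set φ := extChartAt 𝓘(ℝ, E) p with hφ
  set w : E → G := u ∘ φ.symm with hw
  have hwc : ContDiffAt ℝ 2 w (φ p) := by
    have := (contMDiffAt_iff.1 hu).2
    simpa [contDiffWithinAt_univ] using! this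
  have hw1 : ∀ᶠ z in 𝓝 (φ p), ContDiffAt ℝ 2 w z := hwc.eventually (by simp)
  have hcont : ContinuousAt φ p := continuousAt_extChartAt p
  -- With `w` the chart expression of `u`, the chain rule writes `Z u` near `p` as `dw` applied to
  -- the components of `Z`. A second derivative then falls under the product rule.
  have key : ∀ Z : ∀ x : N, TangentSpace 𝓘(ℝ, E) x,
      (fun y ↦ mvfderiv 𝓘(ℝ, E) u y (Z y)) =ᶠ[𝓝 p]
        fun y ↦ fderiv ℝ w (φ y) (comp p ⟨y, Z y⟩) := by
    intro Z
    filter_upwards [hcont.eventually hw1, (chartAt E p).open_source.mem_nhds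
      (mem_chart_source E p)] with y hy hys
    have huw : u =ᶠ[𝓝 y] w ∘ φ := by
      filter_upwards [(chartAt E p).open_source.mem_nhds hys] with z hz
      simp only [hw, Function.comp]
      rw [φ.left_inv (by simpa [hφ] using hz)]
    have hd : DifferentiableAt ℝ w (φ y) := hy.differentiableAt (by simp)
    rw [mvfderiv_congr huw, comp_eq_mfderiv hys]
    have h1 := mfderiv_comp_apply (I := 𝓘(ℝ, E)) y hd.mdifferentiableAt
      (mdifferentiableAt_extChartAt (I := 𝓘(ℝ, E)) hys) (Z y)
    rw [mfderiv_eq_fderiv] at h1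
    exact h1
  have hLd : DifferentiableAt ℝ (fderiv ℝ w) (φ p) :=
    (hwc.fderiv_right (m := 1) (by norm_num)).differentiableAt (by simp)
  have hφd : MDiffAt φ p := mdifferentiableAt_extChartAt (mem_chart_source E p)
  have hL : MDiffAt (fun y ↦ fderiv ℝ w (φ y)) p :=
    (hLd.mdifferentiableAt).comp p hφd
  have hLv : ∀ v : E, mvfderiv 𝓘(ℝ, E) (fun y ↦ fderiv ℝ w (φ y)) p v =
      fderiv ℝ (fderiv ℝ w) (φ p) v := by
    intro v
    have h1 := mfderiv_comp_apply (I := 𝓘(ℝ, E)) p hLd.mdifferentiableAt hφd v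
    rw [mfderiv_eq_fderiv, hφ, mfderiv_extChartAt_self] at h1
    exact h1
  have hself : ∀ v : TangentSpace 𝓘(ℝ, E) p,
      mvfderiv 𝓘(ℝ, E) u p v = fderiv ℝ w (φ p) v := by
    intro v
    -- `key` concerns vector fields, so `v` is realised as the value at `p` of a field.
    have h1 := (key (FiberBundle.extend E v)).self_of_nhds
    simp only [FiberBundle.extend_apply_self, comp_self] at h1
    exact h1
  -- Symmetry of the second derivative cancels the second-order terms. The rest is `dw` applied to
  -- the coordinate expression of the bracket.
  have hsymm : fderiv ℝ (fderiv ℝ w) (φ p) (X p) (Y p) =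
      fderiv ℝ (fderiv ℝ w) (φ p) (Y p) (X p) :=
    (hwc.isSymmSndFDerivAt (by simp)) (X p) (Y p)
  rw [mvfderiv_congr (key X), mvfderiv_congr (key Y), hself,
    mvfderiv_clm_apply hL (mdifferentiableAt_comp hX),
    mvfderiv_clm_apply hL (mdifferentiableAt_comp hY), comp_self, comp_self,
    mlieBracket_eq_comp hX hY]
  have e1 := congrArg (fun L : E →L[ℝ] G ↦ L (Y p)) (hLv (X p))
  have e2 := congrArg (fun L : E →L[ℝ] G ↦ L (X p)) (hLv (Y p))
  have e3 := (fderiv ℝ w (φ p)).map_sub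
    (mvfderiv 𝓘(ℝ, E) (fun y ↦ comp p ⟨y, Y y⟩) p (X p))
    (mvfderiv 𝓘(ℝ, E) (fun y ↦ comp p ⟨y, X y⟩) p (Y p))
  refine e3.trans ?_
  beta_reduce at e1 e2
  rw [e1, e2, hsymm, add_sub_add_left_eq_sub]

end Coordinates

/-! ### The Levi-Civita connection pulled back along `f` -/

section Pullback

variable {E : Type*} [NormedAddCommGroup E] [NormedSpace ℝ E] [FiniteDimensional ℝ E]
  {N : Type*} [TopologicalSpace N] [ChartedSpace E N] [IsManifold 𝓘(ℝ, E) ∞ N]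
  {F : Type*} [NormedAddCommGroup F] [NormedSpace ℝ F] [FiniteDimensional ℝ F]
  {M : Type*} [TopologicalSpace M] [ChartedSpace F M] [IsManifold 𝓘(ℝ, F) ∞ M]
  {g : SemiRiemannianMetric E N}
  {J : ∀ y : N, TangentSpace 𝓘(ℝ, E) y →L[ℝ] TangentSpace 𝓘(ℝ, E) y}
  {f : M → N} {r : ℕ}

/-- `Z` is a smooth section of `TN` along `f`. -/
def IsSmoothAlong (f : M → N) (Z : ∀ x : M, TangentSpace 𝓘(ℝ, E) (f x)) : Prop :=
  ContMDiff 𝓘(ℝ, F) 𝓘(ℝ, E).tangent ∞ (fun x ↦ (⟨f x, Z x⟩ : TangentBundle 𝓘(ℝ, E) N))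

/-- The extension of `Z x` has constant components in the chart at `f x`, so its covariant
derivative is the Christoffel term alone. -/
lemma pullbackDeriv_leviCivita (Z : ∀ x : M, TangentSpace 𝓘(ℝ, E) (f x)) (x : M)
    (v : TangentSpace 𝓘(ℝ, F) x) :
    pullbackDeriv g.leviCivita f Z x v =
      (show E from mvfderiv 𝓘(ℝ, F) (fun y ↦ comp (f x) ⟨f y, Z y⟩) x v) +
        g.christoffel (f x) (Z x) (mfderiv 𝓘(ℝ, F) 𝓘(ℝ, E) f x v) :=
  congrArg (fun w : E ↦ (show E from mvfderiv 𝓘(ℝ, F) (fun y ↦ comp (f x) ⟨f y, Z y⟩) x v) + w)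
    (g.leviCivita_extend (mfderiv 𝓘(ℝ, F) 𝓘(ℝ, E) f x v) (Z x))

lemma IsSmoothAlong.mdifferentiableAt_comp {Z : ∀ x : M, TangentSpace 𝓘(ℝ, E) (f x)}
    (hZ : IsSmoothAlong (F := F) f Z) (x : M) : MDiffAt (fun y ↦ comp (f x) ⟨f y, Z y⟩) x := by
  have h := (contMDiffAt_totalSpace.1 (hZ x)).2
  exact h.mdifferentiableAt (by simp)

lemma isSmoothAlong_push (hf : ContMDiff 𝓘(ℝ, F) 𝓘(ℝ, E) ∞ f)
    {Y : ∀ x : M, TangentSpace 𝓘(ℝ, F) x} (hY : CMDiff ∞ (T% Y)) :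
    IsSmoothAlong (F := F) f (push (E := E) f Y) :=
  (hf.contMDiff_tangentMap (m := ∞) (by simp)).comp hY

/-- The pullback of the Levi-Civita connection is torsion-free. -/
lemma pullbackDeriv_push_sub (hf : ContMDiff 𝓘(ℝ, F) 𝓘(ℝ, E) ∞ f)
    {X Y : ∀ x : M, TangentSpace 𝓘(ℝ, F) x} (hX : CMDiff ∞ (T% X)) (hY : CMDiff ∞ (T% Y)) (x : M) :
    pullbackDeriv g.leviCivita f (push f Y) x (X x) -
      pullbackDeriv g.leviCivita f (push f X) x (Y x) =
        push (E := E) f (VectorField.mlieBracket 𝓘(ℝ, F) X Y) x := by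
  -- The `E`-valued function to differentiate is `f` read in the chart at `f x`: the components of
  -- `df ∘ Z` are its derivative along `Z`, so their antisymmetrised derivatives are given by
  -- `mvfderiv_mlieBracket`. The Christoffel terms cancel by symmetry.
  have hu : CMDiffAt 2 (extChartAt 𝓘(ℝ, E) (f x) ∘ f) x :=
    ((contMDiffAt_extChartAt (n := ∞)).comp x (hf x)).of_le (WithTop.coe_le_coe.2 (le_top : (2 : ℕ∞) ≤ ⊤))
  have hmf : MDiffAt f x := (hf x).mdifferentiableAt (by simp)
  have key : ∀ Z : ∀ x : M, TangentSpace 𝓘(ℝ, F) x,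
      (fun y ↦ comp (f x) ⟨f y, push (E := E) f Z y⟩) =ᶠ[𝓝 x]
        fun y ↦ mvfderiv 𝓘(ℝ, F) (extChartAt 𝓘(ℝ, E) (f x) ∘ f) y (Z y) := by
    intro Z
    filter_upwards [hf.continuous.continuousAt.preimage_mem_nhds
      (chart_source_mem_nhds E (f x))] with y hy
    rw [comp_eq_mfderiv hy]
    exact (mfderiv_comp_apply y (mdifferentiableAt_extChartAt (I := 𝓘(ℝ, E)) hy)
      ((hf y).mdifferentiableAt (by simp)) (Z y)).symm
  have hbr := mvfderiv_mlieBracket hu ((hX x).mdifferentiableAt (by simp))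
    ((hY x).mdifferentiableAt (by simp))
  have hself := (key (VectorField.mlieBracket 𝓘(ℝ, F) X Y)).self_of_nhds
  beta_reduce at hself
  rw [comp_self] at hself
  rw [pullbackDeriv_leviCivita, pullbackDeriv_leviCivita, hself, hbr, mvfderiv_congr (key X),
    mvfderiv_congr (key Y)]
  have hc := g.christoffel_comm (f x) (push f X x) (push f Y x)
  have harith : ∀ a b c d : E, c = d → (a + c) - (b + d) = a - b := fun a b c d h ↦ by
    rw [h]; abel
  exact harith _ _ _ _ hc

/-- The components of `J` at `y`, in the coordinate frame of the preferred chart at `p`. -/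
noncomputable def coordJ (J : ∀ y : N, TangentSpace 𝓘(ℝ, E) y →L[ℝ] TangentSpace 𝓘(ℝ, E) y) (p y : N) :
    E →L[ℝ] E :=
  (trivializationAt (E →L[ℝ] E)
    (fun z : N ↦ TangentSpace 𝓘(ℝ, E) z →L[ℝ] TangentSpace 𝓘(ℝ, E) z) p ⟨y, J y⟩).2

lemma coordJ_apply {p y : N} (hy : y ∈ (chartAt E p).source) (v : TangentSpace 𝓘(ℝ, E) y) :
    coordJ J p y (comp p ⟨y, v⟩) = comp p ⟨y, J y v⟩ := by
  have hb : y ∈ (trivializationAt E (TangentSpace 𝓘(ℝ, E)) p).baseSet := by simpa using hy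
  rw [coordJ, hom_trivializationAt_apply]
  rw [ContinuousLinearMap.inCoordinates_eq hb hb]
  simp [comp, Trivialization.symm_apply_apply_mk _ hb]

lemma coordJ_self (p : N) (v : E) : coordJ J p p v = J p v := by
  have h := coordJ_apply (J := J) (mem_chart_source E p) (v : TangentSpace 𝓘(ℝ, E) p)
  have h1 : comp p ⟨p, (v : TangentSpace 𝓘(ℝ, E) p)⟩ = v := comp_self p v
  rw [h1, comp_self] at h
  exact h

lemma IsIndefiniteKahler.mdifferentiableAt_coordJ (hJ : IsIndefiniteKahler g J) (p : N) :
    MDiffAt (coordJ J p) p := by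
  have h := (contMDiffAt_totalSpace.1 (hJ.contMDiff p)).2
  exact h.mdifferentiableAt (by simp)

/-- The condition `∇J = 0` in coordinates, obtained by testing it on a field with constant
components. In this form it involves only vectors at `p`, so it can be used along `f`, where
sections need not extend to fields on `N`. -/
lemma IsIndefiniteKahler.mvfderiv_coordJ (hJ : IsIndefiniteKahler g J) (p : N)
    (u e : TangentSpace 𝓘(ℝ, E) p) :
    (mvfderiv 𝓘(ℝ, E) (coordJ J p) p u : E →L[ℝ] E) e + g.christoffel p (J p e) u =
      J p (g.christoffel p e u) := by
  have h := hJ.parallel p u (FiberBundle.extend E e)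
    (FiberBundle.contMDiffAt_extend 𝓘(ℝ, E) E _)
  replace h := h.trans (congrArg (J p) (g.leviCivita_extend (p := p) u e))
  have h1 : (fun y ↦ comp p ⟨y, J y (FiberBundle.extend E e y)⟩)
      =ᶠ[𝓝 p] fun y ↦ coordJ J p y e := by
    filter_upwards [chart_source_mem_nhds E p] with y hy
    rw [← coordJ_apply hy]
    congr 1
    have hb : y ∈ (trivializationAt E (TangentSpace 𝓘(ℝ, E)) p).baseSet := by simpa using hy
    have h2 := (trivializationAt E (TangentSpace 𝓘(ℝ, E)) p).apply_mk_symm hb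
      (comp p ⟨p, e⟩)
    exact (congrArg Prod.snd h2).trans (comp_self p e)
  have h3 : ∀ a : E, mvfderiv 𝓘(ℝ, E) (fun y ↦ coordJ J p y a) p u =
      mvfderiv 𝓘(ℝ, E) (coordJ J p) p u a := fun a ↦ by
    have h4 := mvfderiv_clm_apply (hJ.mdifferentiableAt_coordJ p)
      (mdifferentiableAt_const (c := a)) (p := p) u
    rw [mvfderiv_const] at h4
    have h5 : coordJ J p p (0 : E) = 0 := map_zero _
    refine h4.trans ?_
    change _ + coordJ J p p (0 : E) = _
    rw [h5, add_zero]
  have h4 : g.leviCivita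
      (fun y ↦ J y (FiberBundle.extend E e y)) p u =
      mvfderiv 𝓘(ℝ, E)
        (fun y ↦ comp p ⟨y, J y (FiberBundle.extend E e y)⟩) p u +
      g.christoffel p (J p (FiberBundle.extend E e p)) u := rfl
  rw [h4, mvfderiv_congr h1, FiberBundle.extend_apply_self] at h
  refine Eq.trans ?_ h
  exact congrArg (fun w : E ↦ w + g.christoffel p (J p e) u) (h3 e).symm

/-- The pullback of the Levi-Civita connection of a Kähler manifold commutes with `J`. -/
lemma IsIndefiniteKahler.pullbackDeriv_J (hJ : IsIndefiniteKahler g J)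
    (hf : ContMDiff 𝓘(ℝ, F) 𝓘(ℝ, E) ∞ f) {Z : ∀ x : M, TangentSpace 𝓘(ℝ, E) (f x)}
    (hZ : IsSmoothAlong (F := F) f Z) (x : M) (v : TangentSpace 𝓘(ℝ, F) x) :
    pullbackDeriv g.leviCivita f (fun y ↦ J (f y) (Z y)) x v =
      J (f x) (pullbackDeriv g.leviCivita f Z x v) := by
  have hmf : MDiffAt f x := (hf x).mdifferentiableAt (by simp)
  have h1 : (fun y ↦ comp (f x) ⟨f y, J (f y) (Z y)⟩) =ᶠ[𝓝 x]
      fun y ↦ coordJ J (f x) (f y) (comp (f x) ⟨f y, Z y⟩) := by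
    filter_upwards [hf.continuous.continuousAt.preimage_mem_nhds
      (chart_source_mem_nhds E (f x))] with y hy using (coordJ_apply hy _).symm
  have hJd := hJ.mdifferentiableAt_coordJ (f x)
  have h2 : MDiffAt (fun y ↦ coordJ J (f x) (f y)) x := hJd.comp x hmf
  -- By the chain rule the derivative of `J` along `f` is its ambient derivative in the direction
  -- `df v`, where `mvfderiv_coordJ` applies.
  have h3 : mvfderiv 𝓘(ℝ, F) (fun y ↦ coordJ J (f x) (f y)) x v =
      mvfderiv 𝓘(ℝ, E) (coordJ J (f x)) (f x) (mfderiv 𝓘(ℝ, F) 𝓘(ℝ, E) f x v) :=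
    mfderiv_comp_apply x hJd hmf v
  rw [pullbackDeriv_leviCivita, pullbackDeriv_leviCivita, mvfderiv_congr h1,
    mvfderiv_clm_apply h2 (hZ.mdifferentiableAt_comp x), comp_self, h3]
  have h4 := hJ.mvfderiv_coordJ (f x) (mfderiv 𝓘(ℝ, F) 𝓘(ℝ, E) f x v) (Z x)
  have h5 := coordJ_self (J := J) (f x)
    (mvfderiv 𝓘(ℝ, F) (fun y ↦ comp (f x) ⟨f y, Z y⟩) x v)
  have h6 := (J (f x)).map_add (mvfderiv 𝓘(ℝ, F) (fun y ↦ comp (f x) ⟨f y, Z y⟩) x v)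
    (g.christoffel (f x) (Z x) (mfderiv 𝓘(ℝ, F) 𝓘(ℝ, E) f x v))
  have harith : ∀ a b c d e : E, a + c = d → b = e → (a + b) + c = e + d := by
    rintro a b c d e rfl rfl; abel
  exact (harith _ _ _ _ _ h4 h5).trans h6.symm

end Pullback

/-! ### The induced connection and the second fundamental form -/

section Induced

variable {E : Type*} [NormedAddCommGroup E] [NormedSpace ℝ E] [FiniteDimensional ℝ E]
  {N : Type*} [TopologicalSpace N] [ChartedSpace E N] [IsManifold 𝓘(ℝ, E) ∞ N]
  {F : Type*} [NormedAddCommGroup F] [NormedSpace ℝ F] [FiniteDimensional ℝ F]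
  {M : Type*} [TopologicalSpace M] [ChartedSpace F M] [IsManifold 𝓘(ℝ, F) ∞ M]
  {g : SemiRiemannianMetric E N}
  {J : ∀ y : N, TangentSpace 𝓘(ℝ, E) y →L[ℝ] TangentSpace 𝓘(ℝ, E) y}
  {f : M → N} {r : ℕ}

/-- The induced connection is torsion-free. -/
lemma LightlikeSubmanifold.induced_push_sub (Λ : LightlikeSubmanifold (F := F) g f r)
    {X Y : ∀ x : M, TangentSpace 𝓘(ℝ, F) x} (hX : CMDiff ∞ (T% X)) (hY : CMDiff ∞ (T% Y)) (x : M) :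
    Λ.induced X (push f Y) x - Λ.induced Y (push f X) x =
      push (E := E) f (VectorField.mlieBracket 𝓘(ℝ, F) X Y) x := by
  have h := pullbackDeriv_push_sub (g := g) Λ.immersion.contMDiff hX hY x
  have htan : Λ.tan x (push (E := E) f (VectorField.mlieBracket 𝓘(ℝ, F) X Y) x) =
      push (E := E) f (VectorField.mlieBracket 𝓘(ℝ, F) X Y) x :=
    Λ.tan_eq_self x ⟨_, rfl⟩
  rw [← htan, ← h, map_sub]
  rfl

/-- `B h(X, J Z) = 0` if and only if `∇_X Z` lies in `D`. -/
lemma STCR.B_h_J_eq_zero_iff {Λ : LightlikeSubmanifold (F := F) g f r} (σ : STCR J Λ)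
    (hJ : IsIndefiniteKahler g J) (X : ∀ x : M, TangentSpace 𝓘(ℝ, F) x)
    {Z : ∀ x : M, TangentSpace 𝓘(ℝ, E) (f x)} (hZ : IsSmoothAlong (F := F) f Z) (x : M) :
    Λ.B J x (Λ.h X (fun y ↦ J (f y) (Z y)) x) = 0 ↔ Λ.induced X Z x ∈ σ.D x := by
  set JZ : ∀ x : M, TangentSpace 𝓘(ℝ, E) (f x) := fun y ↦ J (f y) (Z y)
  have hA : Λ.ambientDeriv X JZ x = J (f x) (Λ.ambientDeriv X Z x) :=
    hJ.pullbackDeriv_J Λ.immersion.contMDiff hZ x (X x)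
  have hT : Λ.tan x (J (f x) (Λ.induced X JZ x)) ∈ σ.D x :=
    σ.tan_J_mem_D x hJ (Λ.tan_mem x _)
  -- The identity that drives the theorem: `h` is the ambient derivative minus its tangential part,
  -- and `J (∇̄_X JZ) = J² ∇̄_X Z = -∇̄_X Z`.
  have hB : Λ.B J x (Λ.h X JZ x) =
      -Λ.induced X Z x - Λ.tan x (J (f x) (Λ.induced X JZ x)) := by
    change Λ.tan x (J (f x) (Λ.ambientDeriv X JZ x - Λ.induced X JZ x)) = _
    rw [map_sub, map_sub, hA, hJ.sq, map_neg]
    rfl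
  constructor
  · intro h
    rw [hB, sub_eq_zero] at h
    rw [← h] at hT
    exact (Submodule.neg_mem_iff _).1 hT
  · intro h
    refine σ.B_eq_zero_of_mem_D x hJ (Λ.sub_tan_mem x _) ?_
    rw [hB]
    exact Submodule.sub_mem _ (Submodule.neg_mem _ h) hT

end Induced

end LightlikeGeometry

open LightlikeGeometry in
theorem theorem3p6
    {E : Type*} [NormedAddCommGroup E] [NormedSpace ℝ E] [FiniteDimensional ℝ E]
    {N : Type*} [TopologicalSpace N] [T2Space N] [ParacompactSpace N] [ChartedSpace E N]
    [IsManifold 𝓘(ℝ, E) ∞ N]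
    {F : Type*} [NormedAddCommGroup F] [NormedSpace ℝ F] [FiniteDimensional ℝ F]
    {M : Type*} [TopologicalSpace M] [T2Space M] [ParacompactSpace M] [ChartedSpace F M]
    [IsManifold 𝓘(ℝ, F) ∞ M]
    (g : SemiRiemannianMetric E N)
    (J : ∀ y : N, TangentSpace 𝓘(ℝ, E) y →L[ℝ] TangentSpace 𝓘(ℝ, E) y)
    (hJ : IsIndefiniteKahler g J)
    (f : M → N) (r : ℕ) (Λ : LightlikeSubmanifold (F := F) g f r) (σ : STCR J Λ) :
    Λ.DefinesTotallyGeodesicFoliation σ.D ↔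
      ∀ X Y : ∀ x : M, TangentSpace 𝓘(ℝ, F) x,
        Λ.IsSection σ.D X → Λ.IsSection σ.D Y →
          ∀ x : M, Λ.B J x (Λ.h X (fun y ↦ J (f y) (push f Y y)) x) = 0 := by
  have hf := Λ.immersion.contMDiff
  have key : ∀ X Y : ∀ x : M, TangentSpace 𝓘(ℝ, F) x, Λ.IsSection σ.D Y → ∀ x : M,
      (Λ.B J x (Λ.h X (fun y ↦ J (f y) (push f Y y)) x) = 0 ↔
        Λ.induced X (push f Y) x ∈ σ.D x) := fun X Y hY x ↦
    σ.B_h_J_eq_zero_iff hJ X (isSmoothAlong_push hf hY.1) x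
  refine ⟨fun h X Y hX hY x ↦ (key X Y hY x).2 (h.2 X Y hX hY x), fun h ↦ ?_⟩
  have hind : ∀ X Y, Λ.IsSection σ.D X → Λ.IsSection σ.D Y →
      ∀ x, Λ.induced X (push f Y) x ∈ σ.D x :=
    fun X Y hX hY x ↦ (key X Y hY x).1 (h X Y hX hY x)
  refine ⟨fun X Y hX hY x ↦ ?_, hind⟩
  -- Involutivity follows from `[X, Y] = ∇_X Y - ∇_Y X`, with both terms already in `D`.
  rw [← Λ.induced_push_sub hX.1 hY.1]
  exact Submodule.sub_mem _ (hind X Y hX hY x) (hind Y X hY hX x)
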